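/- Let $\Gamma$ be a discrete amenable group. For a nonempty finite set $K\subseteq\Gamma$ and $\delta>0$, a finite nonempty $F\subseteq\Gamma$ is $(K,\delta)$-invariant if $|\{s\in F: Ks\subseteq F\}|\ge(1-\delta)|F|$; amenability means that such $F$ exist for all $K,\delta$. We write $\lim_F\varphi(F)=c$ if for each $\varepsilon>0$ there are $K,\delta$ with $|\varphi(F)-c|<\varepsilon$ for every $(K,\delta)$-invariant $F$. Let $R$ be a unital ring. All modules are left modules, and $\langle A\rangle_R$ denotes the $R$-submodule generated by $A$. Let $\ell$ be a function on the nonempty subsets of an $R\Gamma$-module $\mathcal M$, with values in $[0,+\infty]$. Put $$A^{[F]}:=\sum_{s\in F}s^{-1}A,\qquad \mathrm{m}\ell(A):=\lim_F\frac{\ell(A^{[F]})}{|F|},\qquad \mathrm{m}\ell(\mathcal M):=\sup_A \mathrm{m}\ell(A),$$ where $A$ ranges over the finite subsets of $\mathcal M$ containing $0$. (1) For a $\mathbb Z\Gamma$-module $\mathcal M$ let $h(\mathcal M)$ be its algebraic entropy, that is, $\mathrm{m}\ell(\mathcal M)$ for $\ell(A)=\log|A|$. Then the limits defining $h$ exist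 and are finite, and for all $\mathbb Z\Gamma$-modules $\mathcal M_1\subseteq\mathcal M_2$, $$h(\mathcal M_2)=h(\mathcal M_1)+h(\mathcal M_2/\mathcal M_1).$$ (2) Let $\mathrm L$ be a length function on $R$-modules, i.e. a map from $R$-modules to $[0,+\infty]$ such that $\mathrm L(0)=0$; $\mathrm L(\mathcal M_2)=\mathrm L(\mathcal M_1)+\mathrm L(\mathcal M_3)$ for every short exact sequence $0\to\mathcal M_1\to\mathcal M_2\to\mathcal M_3\to0$; and $\mathrm L(\mathcal M)=\sup_{\mathcal N}\mathrm L(\mathcal N)$ over the finitely generated submodules $\mathcal N$ of $\mathcal M$. An $R\Gamma$-module is locally $\mathrm L$-finite if $\mathrm L$ is finite on each of its finitely generated $R$-submodules. For such a module $\mathcal N$ let the mean length $\mathrm{mL}(\mathcal N)$ be $\mathrm{m}\ell(\mathcal N)$ for $\ell(A)=\mathrm L(\langle A\rangle_R)$. Then the limits defining $\mathrm{mL}$ exist and are finite, and for all locally $\mathrm L$-finite $R\Gamma$-modules $\mathcal N_1\subseteq\mathcal N_2$, $$\mathrm{mL}(\mathcal N_2)=\mathrm{mL}(\mathcal N_1)+\mathrm{mL}(\mathcal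 N_2/\mathcal N_1).$$ -/

import Mathlib

open Filter Topology
open scoped ENNReal NNReal Pointwise

universe u v w

noncomputable section

/-- A finite set `F ⊆ Γ` is `(K, δ)`-invariant if `|{s ∈ F : K s ⊆ F}| ≥ (1 - δ) |F|`. -/
def IsLeftInvariant {Γ : Type w} [Group Γ] (K : Finset Γ) (δ : ℝ) (F : Finset Γ) : Prop :=
  (1 - δ) * (F.card : ℝ) ≤ (({s : Γ | s ∈ F ∧ ∀ k ∈ K, k * s ∈ F}.ncard : ℕ) : ℝ)

/-- The discrete group `Γ` is amenable: for all nonempty finite `K ⊆ Γ` and all `δ > 0` there is a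
nonempty finite `(K, δ)`-invariant subset of `Γ`. -/
def IsAmenableGroup (Γ : Type w) [Group Γ] : Prop :=
  ∀ K : Finset Γ, K.Nonempty → ∀ δ : ℝ, 0 < δ →
    ∃ F : Finset Γ, F.Nonempty ∧ IsLeftInvariant K δ F

theorem IsLeftInvariant.mono {Γ : Type w} [Group Γ] {K K' : Finset Γ} {δ δ' : ℝ} {F : Finset Γ}
    (h : IsLeftInvariant K' δ' F) (hK : K ⊆ K') (hδ : δ' ≤ δ) : IsLeftInvariant K δ F := by
  unfold IsLeftInvariant at *
  have h1 : {s : Γ | s ∈ F ∧ ∀ k ∈ K', k * s ∈ F}.ncard ≤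
      {s : Γ | s ∈ F ∧ ∀ k ∈ K, k * s ∈ F}.ncard := by
    apply Set.ncard_le_ncard
    · rintro s ⟨hs, hs'⟩
      exact ⟨hs, fun k hk => hs' k (hK hk)⟩
    · exact F.finite_toSet.subset fun s hs => hs.1
  have h2 : (1 - δ) * (F.card : ℝ) ≤ (1 - δ') * (F.card : ℝ) := by gcongr
  have h3 := Nat.cast_le (α := ℝ).mpr h1
  linarith

/-- The filter on the finite subsets of `Γ` describing "`F` gets more and more left invariant":
a property holds eventually iff, for some nonempty finite `K ⊆ Γ` and some `δ > 0`, it holds for all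
nonempty finite `(K, δ)`-invariant subsets of `Γ`. -/
def moreLeftInvariant (Γ : Type w) [Group Γ] : Filter (Finset Γ) where
  sets := {S | ∃ K : Finset Γ, K.Nonempty ∧ ∃ δ : ℝ, 0 < δ ∧
    ∀ F : Finset Γ, F.Nonempty → IsLeftInvariant K δ F → F ∈ S}
  univ_sets := ⟨{1}, Finset.singleton_nonempty 1, 1, one_pos, fun _ _ _ => trivial⟩
  sets_of_superset := by
    rintro S T ⟨K, hK, δ, hδ, h⟩ hST
    exact ⟨K, hK, δ, hδ, fun F hF hF' => hST (h F hF hF')⟩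
  inter_sets := by
    classical
    rintro S T ⟨K, hK, δ, hδ, h⟩ ⟨K', -, δ', hδ', h'⟩
    refine ⟨K ∪ K', hK.mono Finset.subset_union_left, min δ δ', lt_min hδ hδ', fun F hF hF' => ?_⟩
    exact ⟨h F hF (hF'.mono Finset.subset_union_left (min_le_left _ _)),
      h' F hF (hF'.mono Finset.subset_union_right (min_le_right _ _))⟩

section MeanWeakLength

variable (R : Type u) [Ring R] {Γ : Type w} [Group Γ]
  {M : Type v} [AddCommGroup M] [Module (MonoidAlgebra R Γ) M]

/-- The set `A^[F] = ∑_{s ∈ F} s⁻¹ A` in an `RΓ`-module. -/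
def translateSum (A : Set M) (F : Finset Γ) : Set M :=
  ∑ s ∈ F, (MonoidAlgebra.of R Γ s⁻¹) • A

/-- The averages `ℓ(A^[F]) / |F|`. -/
def averageWeakLength (ℓ : Set M → ℝ≥0∞) (A : Set M) (F : Finset Γ) : ℝ≥0∞ :=
  ℓ (translateSum R A F) / (F.card : ℝ≥0∞)

variable (Γ)

/-- The limit `mℓ(A)` of the averages `ℓ(A^[F]) / |F|` as `F` gets more and more left invariant. -/
def meanWeakLengthOfSet (ℓ : Set M → ℝ≥0∞) (A : Set M) : ℝ≥0∞ :=
  limUnder (moreLeftInvariant Γ) (averageWeakLength R ℓ A)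

/-- The mean weak length `mℓ(M)` of an `RΓ`-module `M`: the supremum of `mℓ(A)` over all finite
subsets `A` of `M` that contain `0`. -/
def meanWeakLength (ℓ : Set M → ℝ≥0∞) : ℝ≥0∞ :=
  ⨆ (A : Finset M) (_ : (0 : M) ∈ A), meanWeakLengthOfSet R Γ ℓ (A : Set M)

end MeanWeakLength

open Classical in
/-- The weak length `A ↦ log |A|` on (nonempty) subsets of abelian groups, `∞` on infinite sets. -/
def logCard {M : Type v} (A : Set M) : ℝ≥0∞ :=
  if A.Finite then ENNReal.ofReal (Real.log (A.ncard : ℝ)) else ∞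

/-- The algebraic entropy of a `ℤΓ`-module: its mean weak length for `ℓ = log |·|`. -/
def algebraicEntropy (Γ : Type w) [Group Γ] (M : Type v) [AddCommGroup M]
    [Module (MonoidAlgebra ℤ Γ) M] : ℝ≥0∞ :=
  meanWeakLength ℤ Γ (logCard : Set M → ℝ≥0∞)

/-- A length function on (left) `R`-modules. -/
structure LengthFunction (R : Type u) [Ring R] where
  /-- The length of an `R`-module. -/
  len : ∀ (M : Type v) [AddCommGroup M] [Module R M], ℝ≥0∞
  len_zero : ∀ (M : Type v) [AddCommGroup M] [Module R M] [Subsingleton M], len M = 0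
  /-- Additivity on short exact sequences `0 → M₁ → M₂ → M₃ → 0`. -/
  additive : ∀ (M₁ M₂ M₃ : Type v) [AddCommGroup M₁] [AddCommGroup M₂] [AddCommGroup M₃]
    [Module R M₁] [Module R M₂] [Module R M₃] (f : M₁ →ₗ[R] M₂) (g : M₂ →ₗ[R] M₃),
    Function.Injective f → Function.Exact f g → Function.Surjective g →
      len M₂ = len M₁ + len M₃
  upper_continuous : ∀ (M : Type v) [AddCommGroup M] [Module R M],
    len M = ⨆ (N : Submodule R M) (_ : N.FG), len N

namespace LengthFunction

variable {R : Type u} [Ring R] (L : LengthFunction.{u, v} R)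

/-- The module `M` is locally `L`-finite: finitely generated submodules have finite length. -/
def LocallyFinite (M : Type v) [AddCommGroup M] [Module R M] : Prop :=
  ∀ N : Submodule R M, N.FG → L.len N < ∞

/-- The weak length `A ↦ L(⟨A⟩_R)` induced by `L`. -/
def weakLength {M : Type v} [AddCommGroup M] [Module R M] (A : Set M) : ℝ≥0∞ :=
  L.len (Submodule.span R A)

/-- The mean length of an `RΓ`-module `M`. The `R`-module structure of `M` is the one restricted
along `R → RΓ`, as `IsScalarTower` expresses. -/
def meanLength (Γ : Type w) [Group Γ] (M : Type v) [AddCommGroup M]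
    [Module (MonoidAlgebra R Γ) M] [Module R M] [IsScalarTower R (MonoidAlgebra R Γ) M] : ℝ≥0∞ :=
  meanWeakLength R Γ (L.weakLength : Set M → ℝ≥0∞)

end LengthFunction

end

/-! ### Ornstein–Weiss quasi-tilings of almost invariant sets -/

section QuasiTiling

variable {Γ : Type w} [Group Γ]

/-! Both addition formulas are instances of one for weak lengths ℓ: monotone, subadditive,
Γ-invariant functions of sets, finite on finite sets.

The combinatorial input is the Ornstein–Weiss theorem `exists_quasiTiling`: if tiles `T` with a
given property occur arbitrarily far along the invariance filter, finitely many of them suffice to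
cover nearly all of any sufficiently invariant `F` by almost disjoint right translates `T c`, of
total size at most (1 + η)|F|. Hence a bound on ℓ(A^[T]) proportional to |T| propagates from the
tiles to ℓ(A^[F]).

The bounds propagated are relative: `RelBound ℓ x A B` says that replacing A by B next to any
further finite summand costs at most x. Such bounds are translation invariant and add up, and the
corrections B of the finitely many tiles combine into one finite set. The resulting
`eventually_translateSum_le` is used twice. With zero corrections it gives limsup ≤ liminf, hence
the limits. With corrections in the image of M₁ it gives mℓ₂(A) ≤ mℓ₃(gA) + mℓ(M₁), the hard half of
additivity. The other half passes to the limit from ℓ₁(A₁) + ℓ₃(gA₂) ≤ ℓ₂(fA₁ + A₂).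

It remains to verify `IsAdditiveOnExact`: by choosing preimages under g for log |·|, and by the
modular law together with upper continuity for a length function. -/

theorem moreLeftInvariant_neBot (hΓ : IsAmenableGroup Γ) : (moreLeftInvariant Γ).NeBot := by
  refine ⟨fun h => ?_⟩
  have h' : (∅ : Set (Finset Γ)) ∈ moreLeftInvariant Γ := h ▸ mem_bot
  obtain ⟨K, hK, δ, hδ, hF⟩ := h'
  obtain ⟨F, hF1, hF2⟩ := hΓ K hK δ hδ
  exact hF F hF1 hF2

theorem eventually_nonempty : ∀ᶠ F : Finset Γ in moreLeftInvariant Γ, F.Nonempty :=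
  ⟨{1}, Finset.singleton_nonempty 1, 1, one_pos, fun _ h _ => h⟩

theorem eventually_isLeftInvariant {K : Finset Γ} (hK : K.Nonempty) {δ : ℝ} (hδ : 0 < δ) :
    ∀ᶠ F : Finset Γ in moreLeftInvariant Γ, IsLeftInvariant K δ F :=
  ⟨K, hK, δ, hδ, fun _ _ h => h⟩

open Classical in
theorem IsLeftInvariant.card_filter_le {K : Finset Γ} {δ : ℝ} {F : Finset Γ}
    (h : IsLeftInvariant K δ F) :
    (1 - δ) * (F.card : ℝ) ≤ ((F.filter fun s => ∀ k ∈ K, k * s ∈ F).card : ℝ) := by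
  have h1 : {s : Γ | s ∈ F ∧ ∀ k ∈ K, k * s ∈ F} =
      ((F.filter fun s => ∀ k ∈ K, k * s ∈ F : Finset Γ) : Set Γ) := by
    ext s
    simp
  unfold IsLeftInvariant at h
  rwa [h1, Set.ncard_coe_finset] at h

open Classical in
-- If G is the set of s ∈ F with Ks ⊆ F, only the at most δ|F| points of F \ G can be moved out of
-- F, each contributing at most |K| new points.
theorem IsLeftInvariant.card_mul_le {K : Finset Γ} {δ : ℝ} {F : Finset Γ}
    (h : IsLeftInvariant K δ F) :
    ((K * F).card : ℝ) ≤ (1 + K.card * δ) * F.card := by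
  have h1 := h.card_filter_le
  set G := F.filter fun s => ∀ k ∈ K, k * s ∈ F with hG
  have hsub : K * F ⊆ F ∪ K * (F \ G) := by
    intro x hx
    obtain ⟨k, hk, s, hs, rfl⟩ := Finset.mem_mul.1 hx
    by_cases hsG : s ∈ G
    · exact Finset.mem_union_left _ ((Finset.mem_filter.1 hsG).2 k hk)
    · exact Finset.mem_union_right _ (Finset.mul_mem_mul hk (Finset.mem_sdiff.2 ⟨hs, hsG⟩))
  have h2 : (K * F).card ≤ F.card + K.card * (F \ G).card :=
    (Finset.card_le_card hsub).trans ((Finset.card_union_le _ _).trans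
      (Nat.add_le_add_left Finset.card_mul_le _))
  have h3 : (F \ G).card + G.card = F.card :=
    Finset.card_sdiff_add_card_eq_card (Finset.filter_subset _ _)
  have h2' : ((K * F).card : ℝ) ≤ F.card + K.card * (F \ G).card := by exact_mod_cast h2
  have h3' : ((F \ G).card : ℝ) + G.card = F.card := by exact_mod_cast h3
  have h4 : ((F \ G).card : ℝ) ≤ δ * F.card := by linarith
  have h5 : (K.card : ℝ) * (F \ G).card ≤ K.card * (δ * F.card) := by gcongr
  linarith

open Classical in
theorem eventually_card_mul_le (K : Finset Γ) {δ : ℝ} (hδ : 0 < δ) :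
    ∀ᶠ F : Finset Γ in moreLeftInvariant Γ, ((K * F).card : ℝ) ≤ (1 + δ) * F.card := by
  rcases K.eq_empty_or_nonempty with rfl | hK
  · refine Eventually.of_forall fun F => ?_
    simp only [Finset.empty_mul, Finset.card_empty, Nat.cast_zero]
    positivity
  · have hc : (0 : ℝ) < K.card := by exact_mod_cast hK.card_pos
    filter_upwards [eventually_isLeftInvariant hK (div_pos hδ hc)] with F hF
    have h := hF.card_mul_le
    rwa [mul_div_cancel₀ _ hc.ne'] at h

/-- The translate `T c` of a finite subset of a group. -/
abbrev rightTranslate (T : Finset Γ) (c : Γ) : Finset Γ := T.map (mulRightEmbedding c)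

/-- A family `τ` of tiles `T` with centers `c`, together with pairwise disjoint pieces of the
translates `T c` which are `ε`-almost equal to these translates. -/
structure IsQuasiTiling (ε : ℝ) (𝒯 : Finset (Finset Γ)) (F : Finset Γ)
    (τ : Finset (Finset Γ × Γ)) (piece : Finset Γ × Γ → Finset Γ) : Prop where
  tile_mem : ∀ p ∈ τ, p.1 ∈ 𝒯
  center_mem : ∀ p ∈ τ, p.2 ∈ F
  piece_subset : ∀ p ∈ τ, piece p ⊆ F
  piece_subset_tile : ∀ p ∈ τ, piece p ⊆ rightTranslate p.1 p.2
  card_le : ∀ p ∈ τ, (1 - ε) * (p.1.card : ℝ) ≤ (piece p).card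
  disjoint : (τ : Set (Finset Γ × Γ)).PairwiseDisjoint piece

open Classical in
theorem IsQuasiTiling.sum_card_le {ε : ℝ} {𝒯 : Finset (Finset Γ)} {F : Finset Γ}
    {τ : Finset (Finset Γ × Γ)} {piece : Finset Γ × Γ → Finset Γ}
    (h : IsQuasiTiling ε 𝒯 F τ piece) :
    (1 - ε) * ∑ p ∈ τ, (p.1.card : ℝ) ≤ (τ.biUnion piece).card := by
  rw [Finset.card_biUnion h.disjoint, Nat.cast_sum, Finset.mul_sum]
  exact Finset.sum_le_sum h.card_le

open Classical in
/-- From the translates of `T` with centers in `G` one can greedily select almost disjoint ones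
which meet all translates substantially. -/
theorem exists_almost_disjoint_translates {ε : ℝ} (hε : ε ≤ 1) (T G : Finset Γ) :
    ∃ (E : Finset Γ) (piece : Γ → Finset Γ), E ⊆ G ∧
      (∀ c ∈ E, piece c ⊆ rightTranslate T c ∧ (1 - ε) * (T.card : ℝ) ≤ (piece c).card) ∧
      (E : Set Γ).PairwiseDisjoint piece ∧
      ∀ c ∈ G, ε * (T.card : ℝ) ≤ (rightTranslate T c ∩ E.biUnion piece).card := by
  induction G using Finset.induction_on with
  | empty => exact ⟨∅, fun _ => ∅, by simp⟩
  | insert c G hc ih =>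
    obtain ⟨E, piece, hEG, hpiece, hdisj, hmeet⟩ := ih
    by_cases hcase : ε * (T.card : ℝ) ≤ (rightTranslate T c ∩ E.biUnion piece).card
    · refine ⟨E, piece, hEG.trans (Finset.subset_insert _ _), hpiece, hdisj, fun d hd => ?_⟩
      rcases Finset.mem_insert.1 hd with rfl | hd
      · exact hcase
      · exact hmeet d hd
    · have hcE : c ∉ E := fun h => hc (hEG h)
      set H := E.biUnion piece with hH
      -- A translate meeting the selected region H in fewer than ε|T| points is accepted, its piece
      -- being the part outside H; a rejected translate already meets H enough.
      set new : Γ → Finset Γ := Function.update piece c (rightTranslate T c \ H) with hnew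
      have hnewc : new c = rightTranslate T c \ H := Function.update_self ..
      have hnewE : ∀ d ∈ E, new d = piece d := fun d hd =>
        Function.update_of_ne (by rintro rfl; exact hcE hd) _ _
      have hU : (insert c E).biUnion new = rightTranslate T c ∪ H := by
        rw [Finset.biUnion_insert, hnewc, Finset.biUnion_congr rfl hnewE, ← hH,
          Finset.sdiff_union_self_eq_union]
      refine ⟨insert c E, new, Finset.insert_subset_insert _ hEG, fun d hd => ?_, ?_,
        fun d hd => ?_⟩
      · rcases Finset.mem_insert.1 hd with rfl | hd
        · rw [hnewc]
          refine ⟨Finset.sdiff_subset, ?_⟩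
          have h1 := Finset.card_sdiff_add_card_inter (rightTranslate T d) H
          rw [Finset.card_map] at h1
          have h2 : ((rightTranslate T d \ H).card : ℝ) + (rightTranslate T d ∩ H).card = T.card := by
            exact_mod_cast h1
          linarith
        · rw [hnewE d hd]
          exact hpiece d hd
      · rw [Finset.coe_insert, Set.pairwiseDisjoint_insert]
        refine ⟨fun a ha b hb hab => ?_, fun d hd _ => ?_⟩
        · simp only [Function.onFun]
          rw [hnewE a ha, hnewE b hb]
          exact hdisj ha hb hab
        · rw [hnewc, hnewE d hd]
          exact Finset.disjoint_of_subset_right (Finset.subset_biUnion_of_mem piece hd)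
            Finset.sdiff_disjoint
      · rw [hU]
        rcases Finset.mem_insert.1 hd with rfl | hd
        · rw [Finset.inter_eq_left.2 Finset.subset_union_left, Finset.card_map]
          exact mul_le_of_le_one_left (Nat.cast_nonneg _) hε
        · refine (hmeet d hd).trans ?_
          exact_mod_cast Finset.card_le_card
            (Finset.inter_subset_inter_left Finset.subset_union_right)

open Classical in
theorem sum_card_rightTranslate_inter_le (T G H : Finset Γ) :
    ∑ c ∈ G, (rightTranslate T c ∩ H).card ≤ T.card * H.card := by
  have h1 : ∀ c, (rightTranslate T c ∩ H).card = ∑ t ∈ T, if t * c ∈ H then 1 else 0 := by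
    intro c
    rw [← Finset.filter_mem_eq_inter, Finset.filter_map, Finset.card_map, Finset.card_filter]
    rfl
  simp_rw [h1]
  rw [Finset.sum_comm, ← smul_eq_mul, ← Finset.sum_const]
  refine Finset.sum_le_sum fun t _ => ?_
  rw [← Finset.card_filter, ← Finset.card_map (mulLeftEmbedding t)]
  refine Finset.card_le_card fun x hx => ?_
  obtain ⟨c, hc, rfl⟩ := Finset.mem_map.1 hx
  exact (Finset.mem_filter.1 hc).2

open Classical in
-- Double counting: each translate meets the selected region in at least ε|T| points, while a point
-- lies in at most |T| of the translates.
theorem exists_almost_disjoint_translates_card {ε : ℝ} (hε : ε ≤ 1) {T : Finset Γ}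
    (hT : T.Nonempty) (G : Finset Γ) :
    ∃ (E : Finset Γ) (piece : Γ → Finset Γ), E ⊆ G ∧
      (∀ c ∈ E, piece c ⊆ rightTranslate T c ∧ (1 - ε) * (T.card : ℝ) ≤ (piece c).card) ∧
      (E : Set Γ).PairwiseDisjoint piece ∧ ε * (G.card : ℝ) ≤ (E.biUnion piece).card := by
  obtain ⟨E, piece, hEG, hpiece, hdisj, hmeet⟩ := exists_almost_disjoint_translates hε T G
  refine ⟨E, piece, hEG, hpiece, hdisj, ?_⟩
  have h1 := Finset.sum_le_sum hmeet
  rw [Finset.sum_const, nsmul_eq_mul] at h1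
  have h2 : ∑ c ∈ G, ((rightTranslate T c ∩ E.biUnion piece).card : ℝ) ≤
      T.card * (E.biUnion piece).card := by
    exact_mod_cast sum_card_rightTranslate_inter_le T G (E.biUnion piece)
  have hT' : (0 : ℝ) < T.card := by exact_mod_cast hT.card_pos
  refine le_of_mul_le_mul_left ?_ hT'
  linarith

/-- Here f = |F|, h is the covered size, S the total size of the tiles, g the number of centers
still free. As (1 - ε)² - (1 + ε)(1 - 3ε) = 4ε², one gets g ≥ 4ε²f, and new translates cover at
least εg points. -/
theorem coverage_step_arith {ε f h S g h' : ℝ} (hε : 0 < ε) (hε' : ε < 1)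
    (hS : (1 - ε) * S ≤ h) (hg0 : 0 ≤ g) (hg : (1 - ε) * f - (1 + ε) * S ≤ g)
    (hh' : h + ε * g ≤ h') (hh : h ≤ (1 - 3 * ε) * f) : h + 4 * ε ^ 3 * f ≤ h' := by
  have h1 : (1 - ε) * ((1 - ε) * f - (1 + ε) * S) ≤ (1 - ε) * g :=
    mul_le_mul_of_nonneg_left hg (by linarith)
  have h2 : (1 + ε) * ((1 - ε) * S) ≤ (1 + ε) * ((1 - 3 * ε) * f) :=
    mul_le_mul_of_nonneg_left (hS.trans hh) (by linarith)
  have h3 : 4 * ε ^ 2 * f ≤ g := by nlinarith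
  nlinarith

open Classical in
/-- Adding translates of `T` to a quasi-tiling by sets which are very invariant with respect to
`T`. -/
theorem IsQuasiTiling.extend {ε : ℝ} (hε : 0 < ε) (hε' : ε < 1) {𝒯 : Finset (Finset Γ)}
    {F T : Finset Γ} (hT : T.Nonempty) {τ : Finset (Finset Γ × Γ)}
    {piece : Finset Γ × Γ → Finset Γ} (h : IsQuasiTiling ε 𝒯 F τ piece)
    (h𝒯 : ∀ S ∈ 𝒯, ((T⁻¹ * S).card : ℝ) ≤ (1 + ε) * S.card) (hF : IsLeftInvariant T ε F)
    (hcov : ((τ.biUnion piece).card : ℝ) ≤ (1 - 3 * ε) * F.card) :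
    ∃ τ' piece', IsQuasiTiling ε (insert T 𝒯) F τ' piece' ∧
      ((τ.biUnion piece).card : ℝ) + 4 * ε ^ 3 * F.card ≤ (τ'.biUnion piece').card := by
  set H := τ.biUnion piece with hH
  set G₀ := F.filter fun s => ∀ k ∈ T, k * s ∈ F with hG₀
  -- The centers c for which T c lies in F and misses the region H covered so far.
  set G := G₀ \ (T⁻¹ * H) with hG
  have hGF : ∀ c ∈ G, c ∈ F ∧ rightTranslate T c ⊆ F ∧ Disjoint H (rightTranslate T c) := by
    intro c hc
    obtain ⟨hc1, hc2⟩ := Finset.mem_sdiff.1 hc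
    obtain ⟨hc3, hc4⟩ := Finset.mem_filter.1 hc1
    refine ⟨hc3, fun x hx => ?_, Finset.disjoint_left.2 fun x hxH hx => hc2 ?_⟩
    · obtain ⟨t, ht, rfl⟩ := Finset.mem_map.1 hx
      exact hc4 t ht
    · obtain ⟨t, ht, rfl⟩ := Finset.mem_map.1 hx
      exact Finset.mem_mul.2 ⟨t⁻¹, Finset.inv_mem_inv ht, t * c, hxH, by group⟩
  have hTH : ((T⁻¹ * H).card : ℝ) ≤ (1 + ε) * ∑ p ∈ τ, (p.1.card : ℝ) := by
    have hsub : T⁻¹ * H ⊆ τ.biUnion fun p => rightTranslate (T⁻¹ * p.1) p.2 := by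
      intro x hx
      obtain ⟨t, ht, y, hy, rfl⟩ := Finset.mem_mul.1 hx
      obtain ⟨p, hp, hyp⟩ := Finset.mem_biUnion.1 hy
      obtain ⟨s, hs, rfl⟩ := Finset.mem_map.1 (h.piece_subset_tile p hp hyp)
      exact Finset.mem_biUnion.2 ⟨p, hp, Finset.mem_map.2
        ⟨t * s, Finset.mul_mem_mul ht hs, mul_assoc _ _ _⟩⟩
    have h1 := (Finset.card_le_card hsub).trans Finset.card_biUnion_le
    simp only [Finset.card_map] at h1
    have h2 : ((T⁻¹ * H).card : ℝ) ≤ ∑ p ∈ τ, ((T⁻¹ * p.1).card : ℝ) := by exact_mod_cast h1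
    rw [Finset.mul_sum]
    exact h2.trans (Finset.sum_le_sum fun p hp => h𝒯 _ (h.tile_mem p hp))
  have hGcard : (1 - ε) * F.card - (1 + ε) * ∑ p ∈ τ, (p.1.card : ℝ) ≤ G.card := by
    have h1 := hF.card_filter_le
    have h2 : (G₀.card : ℝ) ≤ G.card + (T⁻¹ * H).card := by
      exact_mod_cast Finset.card_le_card_sdiff_add_card
    linarith
  obtain ⟨E, q, hEG, hq, hqdisj, hqcard⟩ := exists_almost_disjoint_translates_card hε'.le hT G
  have hTc : (0 : ℝ) < T.card := by exact_mod_cast hT.card_pos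
  set τE : Finset (Finset Γ × Γ) := E.image (Prod.mk T) with hτE
  have hmemE : ∀ p, p ∈ τE ↔ p.1 = T ∧ p.2 ∈ E := by
    rintro ⟨S, c⟩
    simp only [hτE, Finset.mem_image, Prod.mk.injEq]
    constructor
    · rintro ⟨a, ha, rfl, rfl⟩
      exact ⟨rfl, ha⟩
    · rintro ⟨rfl, hc⟩
      exact ⟨c, hc, rfl, rfl⟩
  -- T may already belong to 𝒯, but an old pair with a center in E would have its piece both inside
  -- H and disjoint from H, hence empty, although its size is at least (1 - ε)|T| > 0.
  have hnot : ∀ p ∈ τ, p ∉ τE := by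
    intro p hp hpE
    obtain ⟨hp1, hp2⟩ := (hmemE p).1 hpE
    have h1 := h.piece_subset_tile p hp
    rw [hp1] at h1
    have h2 : piece p ⊆ H := Finset.subset_biUnion_of_mem piece hp
    have h3 := (hGF p.2 (hEG hp2)).2.2
    have h4 : piece p = ∅ := Finset.disjoint_self_iff_empty _ |>.1
      (Finset.disjoint_of_subset_left h2 (Finset.disjoint_of_subset_right h1 h3))
    have h5 := h.card_le p hp
    rw [h4, hp1] at h5
    simp only [Finset.card_empty, Nat.cast_zero] at h5
    nlinarith
  set r : Finset Γ × Γ → Finset Γ := fun p => if p ∈ τE then q p.2 else piece p with hr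
  have hrE : ∀ p ∈ τE, r p = q p.2 := fun p hp => if_pos hp
  have hrτ : ∀ p ∈ τ, r p = piece p := fun p hp => if_neg (hnot p hp)
  have hqH : ∀ c ∈ E, Disjoint H (q c) := fun c hc =>
    Finset.disjoint_of_subset_right (hq c hc).1 (hGF c (hEG hc)).2.2
  have hU : (τ ∪ τE).biUnion r = H ∪ E.biUnion q := by
    rw [Finset.union_biUnion, Finset.biUnion_congr rfl hrτ, ← hH,
      Finset.biUnion_congr rfl hrE, hτE, Finset.image_biUnion]
  refine ⟨τ ∪ τE, r, ⟨?_, ?_, ?_, ?_, ?_, ?_⟩, ?_⟩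
  · intro p hp
    rcases Finset.mem_union.1 hp with hp | hp
    · exact Finset.mem_insert_of_mem (h.tile_mem p hp)
    · rw [((hmemE p).1 hp).1]
      exact Finset.mem_insert_self _ _
  · intro p hp
    rcases Finset.mem_union.1 hp with hp | hp
    · exact h.center_mem p hp
    · exact (hGF _ (hEG ((hmemE p).1 hp).2)).1
  · intro p hp
    rcases Finset.mem_union.1 hp with hp | hp
    · rw [hrτ p hp]
      exact h.piece_subset p hp
    · have hp2 := ((hmemE p).1 hp).2
      rw [hrE p hp]
      exact (hq _ hp2).1.trans (hGF _ (hEG hp2)).2.1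
  · intro p hp
    rcases Finset.mem_union.1 hp with hp | hp
    · rw [hrτ p hp]
      exact h.piece_subset_tile p hp
    · obtain ⟨hp1, hp2⟩ := (hmemE p).1 hp
      rw [hrE p hp, hp1]
      exact (hq _ hp2).1
  · intro p hp
    rcases Finset.mem_union.1 hp with hp | hp
    · rw [hrτ p hp]
      exact h.card_le p hp
    · obtain ⟨hp1, hp2⟩ := (hmemE p).1 hp
      rw [hrE p hp, hp1]
      exact (hq _ hp2).2
  · rw [Finset.coe_union, Set.pairwiseDisjoint_union]
    refine ⟨fun a ha b hb hab => ?_, fun a ha b hb hab => ?_, fun a ha b hb _ => ?_⟩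
    · simp only [Function.onFun]
      rw [hrτ a ha, hrτ b hb]
      exact h.disjoint ha hb hab
    · obtain ⟨ha1, ha2⟩ := (hmemE a).1 ha
      obtain ⟨hb1, hb2⟩ := (hmemE b).1 hb
      simp only [Function.onFun]
      rw [hrE a ha, hrE b hb]
      exact hqdisj ha2 hb2 fun hab' => hab (Prod.ext (ha1.trans hb1.symm) hab')
    · rw [hrτ a ha, hrE b hb]
      exact Finset.disjoint_of_subset_left (Finset.subset_biUnion_of_mem piece ha)
        (hqH _ ((hmemE b).1 hb).2)
  · rw [hU]
    have hd : Disjoint H (E.biUnion q) := (Finset.disjoint_biUnion_right _ _ _).2 hqH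
    rw [Finset.card_union_of_disjoint hd, Nat.cast_add]
    refine coverage_step_arith hε hε' h.sum_card_le (Nat.cast_nonneg G.card)
      hGcard ?_ hcov
    linarith

open Classical in
theorem exists_quasiTiling_coverage {ε : ℝ} (hε : 0 < ε) (hε' : ε < 1) (n : ℕ) :
    ∀ P : Finset Γ → Prop, (∃ᶠ T in moreLeftInvariant Γ, P T) →
      ∃ 𝒯 : Finset (Finset Γ), (∀ T ∈ 𝒯, P T) ∧ ∀ᶠ F in moreLeftInvariant Γ,
        ∃ τ piece, IsQuasiTiling ε 𝒯 F τ piece ∧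
          min (n * (4 * ε ^ 3)) (1 - 3 * ε) * (F.card : ℝ) ≤ (τ.biUnion piece).card := by
  induction n with
  | zero =>
    intro P _
    refine ⟨∅, by simp, Eventually.of_forall fun F => ⟨∅, fun _ => ∅,
      ⟨by simp, by simp, by simp, by simp, by simp, by simp⟩, ?_⟩⟩
    simp only [Nat.cast_zero, zero_mul, Finset.biUnion_empty, Finset.card_empty]
    exact mul_nonpos_of_nonpos_of_nonneg (min_le_left _ _) (Nat.cast_nonneg _)
  | succ n ih =>
    intro P hP
    -- The tile chosen first is placed last: the other tiles are then required to be almost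
    -- invariant under T⁻¹, which is why the induction quantifies over the property P.
    obtain ⟨T, hPT, hT⟩ := (hP.and_eventually eventually_nonempty).exists
    obtain ⟨𝒯, h𝒯, hF⟩ := ih _ (hP.and_eventually (eventually_card_mul_le T⁻¹ hε))
    refine ⟨insert T 𝒯, fun S hS => ?_, ?_⟩
    · rcases Finset.mem_insert.1 hS with rfl | hS
      · exact hPT
      · exact (h𝒯 S hS).1
    · filter_upwards [hF, eventually_isLeftInvariant hT hε] with F hF hFT
      obtain ⟨τ, piece, hτ, hcov⟩ := hF
      by_cases hc : ((τ.biUnion piece).card : ℝ) ≤ (1 - 3 * ε) * F.card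
      · obtain ⟨τ', piece', hτ', hcov'⟩ := hτ.extend hε hε' hT (fun S hS => (h𝒯 S hS).2) hFT hc
        refine ⟨τ', piece', hτ', le_trans ?_ hcov'⟩
        have hmin : min ((n + 1 : ℕ) * (4 * ε ^ 3)) (1 - 3 * ε) ≤
            min (n * (4 * ε ^ 3)) (1 - 3 * ε) + 4 * ε ^ 3 := by
          have h3 : (0 : ℝ) < 4 * ε ^ 3 := by positivity
          rw [← min_add_add_right]
          refine min_le_min (le_of_eq (by push_cast; ring)) (by linarith)
        have := mul_le_mul_of_nonneg_right hmin (Nat.cast_nonneg (α := ℝ) F.card)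
        linarith
      · refine ⟨τ, piece, ⟨fun p hp => Finset.mem_insert_of_mem (hτ.tile_mem p hp), hτ.center_mem,
          hτ.piece_subset, hτ.piece_subset_tile, hτ.card_le, hτ.disjoint⟩, ?_⟩
        refine le_trans ?_ (not_le.1 hc).le
        exact mul_le_mul_of_nonneg_right (min_le_right _ _) (Nat.cast_nonneg _)

open Classical in
/-- The quasi-tiling theorem of Ornstein and Weiss. -/
theorem exists_quasiTiling {η : ℝ} (hη : 0 < η) {P : Finset Γ → Prop}
    (hP : ∃ᶠ T in moreLeftInvariant Γ, P T) :
    ∃ (ε : ℝ) (𝒯 : Finset (Finset Γ)), (∀ T ∈ 𝒯, P T) ∧ ∀ᶠ F in moreLeftInvariant Γ,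
      ∃ τ piece, IsQuasiTiling ε 𝒯 F τ piece ∧
        ∑ p ∈ τ, (p.1.card : ℝ) ≤ (1 + η) * F.card ∧
        ((F \ τ.biUnion piece).card : ℝ) ≤ η * F.card := by
  set ε : ℝ := min (η / 3) 1 / 2 with hεdef
  have hm : 0 < min (η / 3) 1 := lt_min (by positivity) one_pos
  have hε : 0 < ε := by positivity
  have hε1 : ε ≤ 1 / 2 := by
    have := min_le_right (η / 3) 1
    linarith
  have hεη : 6 * ε ≤ η := by
    have := min_le_left (η / 3) 1
    linarith
  -- Each round gains 4ε³|F|, so n rounds reach the coverage 1 - 3ε.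
  obtain ⟨n, hn⟩ := exists_nat_gt (1 / (4 * ε ^ 3))
  have hn' : 1 ≤ n * (4 * ε ^ 3) := by
    rw [div_lt_iff₀ (by positivity)] at hn
    exact hn.le
  obtain ⟨𝒯, h𝒯, hF⟩ := exists_quasiTiling_coverage hε (by linarith) n P hP
  refine ⟨ε, 𝒯, h𝒯, ?_⟩
  filter_upwards [hF] with F hF
  obtain ⟨τ, piece, hτ, hcov⟩ := hF
  rw [min_eq_right (by linarith)] at hcov
  have hsub : τ.biUnion piece ⊆ F := Finset.biUnion_subset.2 hτ.piece_subset
  have h1 : ((F \ τ.biUnion piece).card : ℝ) + (τ.biUnion piece).card = F.card := by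
    exact_mod_cast Finset.card_sdiff_add_card_eq_card hsub
  have h2 := hτ.sum_card_le
  have hFc : (0 : ℝ) ≤ F.card := Nat.cast_nonneg _
  refine ⟨τ, piece, hτ, ?_, ?_⟩
  · have h0 : (0 : ℝ) ≤ (F \ τ.biUnion piece).card := Nat.cast_nonneg _
    have h3 : (1 - ε) * ∑ p ∈ τ, (p.1.card : ℝ) ≤ (1 - ε) * ((1 + η) * F.card) := by
      refine (h2.trans (by linarith : _ ≤ (F.card : ℝ))).trans ?_
      have : 1 ≤ (1 - ε) * (1 + η) := by nlinarith
      nlinarith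
    exact le_of_mul_le_mul_left h3 (by linarith)
  · have : 3 * ε * F.card ≤ η * F.card := mul_le_mul_of_nonneg_right (by linarith) hFc
    linarith

end QuasiTiling

/-! ### Weak lengths, relative bounds and existence of the limits -/

section WeakLength

variable {R : Type u} [Ring R] {Γ : Type w} [Group Γ]
  {M : Type v} [AddCommGroup M] [Module (MonoidAlgebra R Γ) M]

theorem zero_mem_smul_set_of_zero_mem (a : MonoidAlgebra R Γ) {A : Set M} (hA : (0 : M) ∈ A) :
    (0 : M) ∈ a • A :=
  ⟨0, hA, smul_zero a⟩

theorem zero_mem_finsetSum {ι N : Type*} [AddCommMonoid N] {s : Finset ι} {A : ι → Set N}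
    (hA : ∀ i ∈ s, (0 : N) ∈ A i) : (0 : N) ∈ ∑ i ∈ s, A i := by
  have h := Set.finsetSum_mem_finsetSum s A (fun _ => 0) hA
  rwa [Finset.sum_const_zero] at h

theorem finite_finsetSum {ι N : Type*} [AddCommMonoid N] {s : Finset ι} {A : ι → Set N}
    (hA : ∀ i ∈ s, (A i).Finite) : (∑ i ∈ s, A i).Finite := by
  classical
  induction s using Finset.induction_on with
  | empty => simp
  | insert i s hi ih =>
    rw [Finset.sum_insert hi]
    exact (hA i (Finset.mem_insert_self _ _)).add
      (ih fun j hj => hA j (Finset.mem_insert_of_mem hj))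

theorem finsetSum_subset_of_subset {ι N : Type*} [AddCommMonoid N] {s t : Finset ι}
    {A : ι → Set N} (hst : s ⊆ t) (hA : ∀ i ∈ t, (0 : N) ∈ A i) :
    ∑ i ∈ s, A i ⊆ ∑ i ∈ t, A i := by
  classical
  rw [← Finset.sum_sdiff hst]
  exact Set.subset_add_right _
    (zero_mem_finsetSum fun i hi => hA i (Finset.mem_sdiff.1 hi).1)

theorem zero_mem_translateSum {A : Set M} (hA : (0 : M) ∈ A) (F : Finset Γ) :
    (0 : M) ∈ translateSum R A F :=
  zero_mem_finsetSum fun _ _ => zero_mem_smul_set_of_zero_mem _ hA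

theorem finite_translateSum {A : Set M} (hA : A.Finite) (F : Finset Γ) :
    (translateSum R A F).Finite :=
  finite_finsetSum fun _ _ => hA.image _

theorem translateSum_subset {A : Set M} (hA : (0 : M) ∈ A) {F F' : Finset Γ} (h : F ⊆ F') :
    translateSum R A F ⊆ translateSum R A F' :=
  finsetSum_subset_of_subset h fun _ _ => zero_mem_smul_set_of_zero_mem _ hA

theorem translateSum_add (A B : Set M) (F : Finset Γ) :
    translateSum R (A + B) F = translateSum R A F + translateSum R B F := by
  simp only [translateSum, smul_add, Finset.sum_add_distrib]

theorem translateSum_zero (F : Finset Γ) : translateSum R (0 : Set M) F = 0 := by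
  simp only [translateSum, smul_zero, Finset.sum_const_zero]

/-- Since (tc)⁻¹ = c⁻¹t⁻¹, the inverses in A^[F] turn right translates of tiles into module
translates of the single set A^[T]. -/
theorem translateSum_rightTranslate (A : Set M) (F : Finset Γ) (c : Γ) :
    translateSum R A (rightTranslate F c) =
      (MonoidAlgebra.of R Γ c⁻¹) • translateSum R A F := by
  simp only [translateSum, Finset.sum_map, Finset.smul_sum, smul_smul, mulRightEmbedding_apply,
    mul_inv_rev, map_mul]

theorem image_translateSum {M' : Type*} [AddCommGroup M'] [Module (MonoidAlgebra R Γ) M']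
    (f : M →ₗ[MonoidAlgebra R Γ] M') (A : Set M) (F : Finset Γ) :
    f '' translateSum R A F = translateSum R (f '' A) F := by
  simp only [translateSum, Set.image_finsetSum]
  exact Finset.sum_congr rfl fun s _ => Set.image_smul_comm f _ _ fun b => f.map_smul _ b

variable (R Γ) in
/-- A translation invariant weak length function on the subsets of an `RΓ`-module. -/
structure IsWeakLength (ℓ : Set M → ℝ≥0∞) : Prop where
  mono : ∀ {A B : Set M}, A ⊆ B → ℓ A ≤ ℓ B
  add_le : ∀ A B : Set M, ℓ (A + B) ≤ ℓ A + ℓ B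
  smul_le : ∀ (s : Γ) (A : Set M), ℓ ((MonoidAlgebra.of R Γ s) • A) ≤ ℓ A
  zero : ℓ 0 = 0
  lt_top : ∀ {A : Set M}, A.Finite → ℓ A < ∞

namespace IsWeakLength

variable {ℓ : Set M → ℝ≥0∞}

theorem translateSum_le (hℓ : IsWeakLength R Γ ℓ) (A : Set M) (F : Finset Γ) :
    ℓ (translateSum R A F) ≤ F.card * ℓ A := by
  classical
  unfold translateSum
  induction F using Finset.induction_on with
  | empty => simp [hℓ.zero]
  | insert s F hs ih =>
    rw [Finset.sum_insert hs, Finset.card_insert_of_notMem hs, Nat.cast_succ, add_mul, one_mul,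
      add_comm (_ * _)]
    exact (hℓ.add_le _ _).trans (add_le_add (hℓ.smul_le _ _) ih)

/-- The sets `A` whose weak length is at most `x`, up to a correction by the set `B`. -/
def RelBound (ℓ : Set M → ℝ≥0∞) (x : ℝ≥0∞) (A B : Set M) : Prop :=
  ∀ D : Set M, D.Finite → (0 : M) ∈ D → ℓ (A + D) ≤ x + ℓ (B + D)

theorem RelBound.smul (hℓ : IsWeakLength R Γ ℓ) {x : ℝ≥0∞} {A B : Set M}
    (h : RelBound ℓ x A B) (s : Γ) :
    RelBound ℓ x ((MonoidAlgebra.of R Γ s) • A) ((MonoidAlgebra.of R Γ s) • B) := by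
  intro D hD hD0
  have h1 := h ((MonoidAlgebra.of R Γ s⁻¹) • D) (hD.image _) (zero_mem_smul_set_of_zero_mem _ hD0)
  have h2 := hℓ.smul_le s (A + (MonoidAlgebra.of R Γ s⁻¹) • D)
  have h3 := hℓ.smul_le s⁻¹ ((MonoidAlgebra.of R Γ s) • B + D)
  rw [smul_add, smul_smul, ← map_mul, mul_inv_cancel, map_one, one_smul] at h2
  rw [smul_add, smul_smul, ← map_mul, inv_mul_cancel, map_one, one_smul] at h3
  exact h2.trans (h1.trans (by gcongr))

/-- The summands are replaced one at a time, all others being absorbed into D; this is why a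
relative bound quantifies over D. -/
theorem RelBound.sum {ι : Type*} {s : Finset ι} {x : ι → ℝ≥0∞} {A B : ι → Set M}
    (hA : ∀ i ∈ s, (A i).Finite ∧ (0 : M) ∈ A i) (hB : ∀ i ∈ s, (B i).Finite ∧ (0 : M) ∈ B i)
    (h : ∀ i ∈ s, RelBound ℓ (x i) (A i) (B i)) :
    RelBound ℓ (∑ i ∈ s, x i) (∑ i ∈ s, A i) (∑ i ∈ s, B i) := by
  classical
  induction s using Finset.induction_on with
  | empty => intro D _ _; simp
  | insert i s hi ih =>
    intro D hD hD0
    have hA' := fun j hj => hA j (Finset.mem_insert_of_mem hj)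
    have hB' := fun j hj => hB j (Finset.mem_insert_of_mem hj)
    obtain ⟨hBi, hBi0⟩ := hB i (Finset.mem_insert_self _ _)
    have h1 := h i (Finset.mem_insert_self _ _) (∑ j ∈ s, A j + D)
      ((finite_finsetSum fun j hj => (hA' j hj).1).add hD)
      ⟨0, zero_mem_finsetSum fun j hj => (hA' j hj).2, 0, hD0, add_zero 0⟩
    have h2 := ih hA' hB' (fun j hj => h j (Finset.mem_insert_of_mem hj)) (B i + D)
      (hBi.add hD) ⟨0, hBi0, 0, hD0, add_zero 0⟩
    rw [Finset.sum_insert hi, Finset.sum_insert hi, Finset.sum_insert hi, add_assoc, add_assoc,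
      add_assoc]
    rw [add_left_comm] at h2
    refine h1.trans (add_le_add le_rfl ?_)
    rwa [add_left_comm (B i), add_left_comm (∑ j ∈ s, B j)] at *

/-- If sufficiently many of the sets `A^[T]` are bounded up to corrections within `N`, then so are
eventually all of them. -/
theorem eventually_translateSum_le (hℓ : IsWeakLength R Γ ℓ) (N : AddSubmonoid M) {A : Set M}
    (hA : A.Finite) (hA0 : (0 : M) ∈ A) (x : ℝ≥0∞)
    (h : ∃ᶠ T : Finset Γ in moreLeftInvariant Γ, ∃ B : Set M, B.Finite ∧ (0 : M) ∈ B ∧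
      B ⊆ N ∧ RelBound ℓ (x * T.card) (translateSum R A T) B) {η : ℝ≥0} (hη : 0 < η) :
    ∃ B : Set M, B.Finite ∧ (0 : M) ∈ B ∧ B ⊆ N ∧ ∀ᶠ F : Finset Γ in moreLeftInvariant Γ,
      ℓ (translateSum R A F) ≤
        x * ((1 + η) * F.card) + η * F.card * ℓ A + ℓ (translateSum R B F) := by
  classical
  obtain ⟨ε, 𝒯, h𝒯, hF⟩ := exists_quasiTiling (NNReal.coe_pos.2 hη) h
  -- Each tile has its own correction; 𝒯 is finite and independent of F, so their sum is a single
  -- finite set serving every F.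
  choose! B hBfin hB0 hBN hB using h𝒯
  refine ⟨∑ T ∈ 𝒯, B T, finite_finsetSum hBfin, zero_mem_finsetSum hB0, ?_, ?_⟩
  · intro b hb
    obtain ⟨g, hg, rfl⟩ := (Set.mem_finsetSum _ _ _).1 hb
    exact sum_mem fun T hT => hBN T hT (hg hT)
  · filter_upwards [hF] with F hF
    obtain ⟨τ, piece, hτ, hsum, hrest⟩ := hF
    have hsum' : ∑ p ∈ τ, (p.1.card : ℝ≥0∞) ≤ (1 + η) * F.card := by
      have h1 : ∑ p ∈ τ, (p.1.card : ℝ≥0) ≤ (1 + η) * F.card := by exact_mod_cast hsum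
      exact_mod_cast h1
    have hrest' : ((F \ τ.biUnion piece).card : ℝ≥0∞) ≤ η * F.card := by
      have h1 : ((F \ τ.biUnion piece).card : ℝ≥0) ≤ η * F.card := by exact_mod_cast hrest
      exact_mod_cast h1
    have hsub : τ.biUnion piece ⊆ F := Finset.biUnion_subset.2 hτ.piece_subset
    set S : Finset Γ × Γ → Set M := fun p =>
      (MonoidAlgebra.of R Γ p.2⁻¹) • translateSum R A p.1 with hS
    set C : Finset Γ × Γ → Set M := fun p => (MonoidAlgebra.of R Γ p.2⁻¹) • B p.1 with hC
    have hcover : translateSum R A F ⊆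
        ∑ p ∈ τ, S p + translateSum R A (F \ τ.biUnion piece) := by
      have h1 : translateSum R A F = ∑ p ∈ τ, translateSum R A (piece p) +
          translateSum R A (F \ τ.biUnion piece) := by
        simp only [translateSum]
        rw [← Finset.sum_biUnion hτ.disjoint, add_comm, Finset.sum_sdiff hsub]
      rw [h1]
      refine Set.add_subset_add_right (Set.finsetSum_subset_finsetSum _ _ _ fun p hp => ?_)
      change _ ⊆ (MonoidAlgebra.of R Γ p.2⁻¹) • translateSum R A p.1
      rw [← translateSum_rightTranslate]
      exact translateSum_subset hA0 (hτ.piece_subset_tile p hp)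
    -- The pairs (T, c) are distinct elements of 𝒯 × F, so the corrections form a partial sum of the
    -- right-hand side; the centers must lie in F for this.
    have hcorr : ∑ p ∈ τ, C p ⊆ translateSum R (∑ T ∈ 𝒯, B T) F := by
      have h1 : translateSum R (∑ T ∈ 𝒯, B T) F = ∑ p ∈ 𝒯 ×ˢ F, C p := by
        simp only [translateSum, Finset.smul_sum, hC]
        rw [Finset.sum_product_right]
      rw [h1]
      refine finsetSum_subset_of_subset (fun p hp => Finset.mem_product.2
        ⟨hτ.tile_mem p hp, hτ.center_mem p hp⟩) fun p hp => ?_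
      exact zero_mem_smul_set_of_zero_mem _ (hB0 _ (Finset.mem_product.1 hp).1)
    have hrel : RelBound ℓ (∑ p ∈ τ, x * (p.1.card : ℝ≥0∞)) (∑ p ∈ τ, S p) (∑ p ∈ τ, C p) := by
      refine RelBound.sum (fun p _ => ?_) (fun p hp => ?_) fun p hp => ?_
      · exact ⟨(finite_translateSum hA _).image _,
          zero_mem_smul_set_of_zero_mem _ (zero_mem_translateSum hA0 _)⟩
      · exact ⟨(hBfin _ (hτ.tile_mem p hp)).image _,
          zero_mem_smul_set_of_zero_mem _ (hB0 _ (hτ.tile_mem p hp))⟩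
      · exact (hB _ (hτ.tile_mem p hp)).smul hℓ _
    calc ℓ (translateSum R A F)
        ≤ ℓ (∑ p ∈ τ, S p + translateSum R A (F \ τ.biUnion piece)) := hℓ.mono hcover
      _ ≤ ∑ p ∈ τ, x * (p.1.card : ℝ≥0∞) +
            ℓ (∑ p ∈ τ, C p + translateSum R A (F \ τ.biUnion piece)) :=
          hrel _ (finite_translateSum hA _) (zero_mem_translateSum hA0 _)
      _ ≤ x * ((1 + η) * F.card) +
            (ℓ (translateSum R (∑ T ∈ 𝒯, B T) F) + η * F.card * ℓ A) := by
          rw [← Finset.mul_sum]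
          refine add_le_add (by gcongr) ((hℓ.add_le _ _).trans
            (add_le_add (hℓ.mono hcorr) ((hℓ.translateSum_le _ _).trans (by gcongr))))
      _ = _ := by ring

/-- The error terms which occur in the two applications of the quasi-tiling theorem. -/
theorem _root_.ENNReal.le_add_of_forall_pos_le_mul_add {x a s y : ℝ≥0∞} (hx : x ≠ ∞) (ha : a ≠ ∞)
    (h : ∀ ε : ℝ≥0, 0 < ε → y ≤ (x + ε) * (1 + ε) + ε * a + s) : y ≤ x + s := by
  have hlim : Tendsto (fun ε : ℝ≥0 => (x + ε) * (1 + ε) + ε * a + s) (𝓝[>] 0)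
      (𝓝 ((x + (0 : ℝ≥0)) * (1 + (0 : ℝ≥0)) + (0 : ℝ≥0) * a + s)) := by
    have hc : Tendsto (fun ε : ℝ≥0 => (ε : ℝ≥0∞)) (𝓝[>] 0) (𝓝 ((0 : ℝ≥0) : ℝ≥0∞)) :=
      (ENNReal.continuous_coe.tendsto 0).mono_left nhdsWithin_le_nhds
    refine ((ENNReal.Tendsto.mul (hc.const_add x) (Or.inr (by simp)) (hc.const_add 1)
      (Or.inr (by simpa using hx))).add (ENNReal.Tendsto.mul_const hc (Or.inr ha))).add_const s
  simp only [ENNReal.coe_zero, add_zero, mul_one, zero_mul] at hlim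
  exact ge_of_tendsto hlim (eventually_nhdsWithin_of_forall fun ε hε => h ε hε)

/-- A bound on averages from a bound on lengths. -/
theorem averageWeakLength_le_of_le {A B : Set M} (x y a : ℝ≥0∞) {F : Finset Γ}
    (hF : F.Nonempty)
    (h : ℓ (translateSum R A F) ≤ x * (y * F.card) + a * F.card + ℓ (translateSum R B F)) :
    averageWeakLength R ℓ A F ≤ x * y + a + averageWeakLength R ℓ B F := by
  have h0 : (F.card : ℝ≥0∞) ≠ 0 := by exact_mod_cast hF.card_pos.ne'
  unfold averageWeakLength
  refine (ENNReal.div_le_div_right h _).trans (le_of_eq ?_)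
  rw [ENNReal.add_div, ← mul_assoc, ← add_mul, ENNReal.mul_div_cancel_right h0 (by simp)]

theorem averageWeakLength_le (hℓ : IsWeakLength R Γ ℓ) (A : Set M) {F : Finset Γ}
    (hF : F.Nonempty) : averageWeakLength R ℓ A F ≤ ℓ A := by
  have h0 : (F.card : ℝ≥0∞) ≠ 0 := by exact_mod_cast hF.card_pos.ne'
  refine ENNReal.div_le_of_le_mul ?_
  rw [mul_comm]
  exact hℓ.translateSum_le A F

/-- Averages below liminf + ε occur frequently; by subadditivity they are relative bounds with
correction {0}, and the quasi-tiling makes them hold eventually up to small errors, so limsup ≤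
liminf. -/
theorem exists_tendsto (hΓ : IsAmenableGroup Γ) (hℓ : IsWeakLength R Γ ℓ) {A : Set M}
    (hA : A.Finite) (hA0 : (0 : M) ∈ A) :
    ∃ c : ℝ≥0, Tendsto (averageWeakLength (Γ := Γ) R ℓ A) (moreLeftInvariant Γ)
      (𝓝 (c : ℝ≥0∞)) := by
  have := moreLeftInvariant_neBot hΓ
  set x := liminf (averageWeakLength (Γ := Γ) R ℓ A) (moreLeftInvariant Γ) with hx
  have hxtop : x ≠ ∞ := by
    refine ((liminf_le_of_le (a := ℓ A) (by isBoundedDefault) fun b hb => ?_).trans_lt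
      (hℓ.lt_top hA)).ne
    obtain ⟨F, hF1, hF2⟩ := (hb.and eventually_nonempty).exists
    exact hF1.trans (hℓ.averageWeakLength_le A hF2)
  refine ⟨x.toNNReal, ?_⟩
  rw [ENNReal.coe_toNNReal hxtop]
  refine tendsto_of_le_liminf_of_limsup_le le_rfl ?_
  rw [← add_zero x]
  refine ENNReal.le_add_of_forall_pos_le_mul_add hxtop (hℓ.lt_top hA).ne fun ε hε => ?_
  have hlt : x < x + ε := ENNReal.lt_add_right hxtop (by simpa using hε.ne')
  have hfreq := frequently_lt_of_liminf_lt (by isBoundedDefault) (hx ▸ hlt)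
  have hrel : ∃ᶠ T : Finset Γ in moreLeftInvariant Γ, ∃ B : Set M, B.Finite ∧ (0 : M) ∈ B ∧
      B ⊆ (⊥ : AddSubmonoid M) ∧ RelBound ℓ ((x + ε) * T.card) (translateSum R A T) B := by
    refine (hfreq.and_eventually eventually_nonempty).mono fun T hT =>
      ⟨0, Set.finite_zero, rfl, by simp, fun D _ _ => ?_⟩
    rw [zero_add]
    refine (hℓ.add_le _ _).trans (add_le_add ?_ le_rfl)
    have h0 : (T.card : ℝ≥0∞) ≠ 0 := by exact_mod_cast hT.2.card_pos.ne'
    exact (ENNReal.div_le_iff h0 (by simp)).1 hT.1.le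
  obtain ⟨B, -, -, hBN, hB⟩ := hℓ.eventually_translateSum_le ⊥ hA hA0 (x + ε) hrel hε
  refine limsup_le_of_le (by isBoundedDefault) ?_
  filter_upwards [hB, eventually_nonempty] with F hF hF0
  have hB0 : ℓ (translateSum R B F) ≤ ℓ (translateSum R (0 : Set M) F) :=
    hℓ.mono (Set.finsetSum_subset_finsetSum _ _ _ fun s _ => Set.smul_set_mono hBN)
  refine (averageWeakLength_le_of_le (x + ε) (1 + ε) (ε * ℓ A) hF0
    ((hF.trans (add_le_add le_rfl hB0)).trans (le_of_eq (by ring)))).trans (le_of_eq ?_)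
  rw [averageWeakLength, translateSum_zero, hℓ.zero, ENNReal.zero_div]

theorem tendsto_meanWeakLengthOfSet (hΓ : IsAmenableGroup Γ) (hℓ : IsWeakLength R Γ ℓ) {A : Set M}
    (hA : A.Finite) (hA0 : (0 : M) ∈ A) :
    Tendsto (averageWeakLength (Γ := Γ) R ℓ A) (moreLeftInvariant Γ)
      (𝓝 (meanWeakLengthOfSet R Γ ℓ A)) := by
  have := moreLeftInvariant_neBot hΓ
  obtain ⟨c, hc⟩ := hℓ.exists_tendsto hΓ hA hA0
  rwa [meanWeakLengthOfSet, hc.limUnder_eq]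

theorem meanWeakLengthOfSet_ne_top (hΓ : IsAmenableGroup Γ) (hℓ : IsWeakLength R Γ ℓ) {A : Set M}
    (hA : A.Finite) (hA0 : (0 : M) ∈ A) : meanWeakLengthOfSet R Γ ℓ A ≠ ∞ := by
  have := moreLeftInvariant_neBot hΓ
  obtain ⟨c, hc⟩ := hℓ.exists_tendsto hΓ hA hA0
  rw [meanWeakLengthOfSet, hc.limUnder_eq]
  exact ENNReal.coe_ne_top

theorem meanWeakLengthOfSet_le_meanWeakLength {A : Set M} (hA : A.Finite) (hA0 : (0 : M) ∈ A) :
    meanWeakLengthOfSet R Γ ℓ A ≤ meanWeakLength R Γ ℓ := by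
  lift A to Finset M using hA
  exact le_iSup₂ (f := fun (A : Finset M) (_ : (0 : M) ∈ A) =>
    meanWeakLengthOfSet R Γ ℓ (A : Set M)) A (Finset.mem_coe.1 hA0)

end IsWeakLength

end WeakLength

/-! ### The addition formula for abstract weak lengths -/

section Addition

variable {R : Type u} [Ring R] {Γ : Type w} [Group Γ] {M₁ M₂ M₃ : Type v}
  [AddCommGroup M₁] [Module (MonoidAlgebra R Γ) M₁]
  [AddCommGroup M₂] [Module (MonoidAlgebra R Γ) M₂]
  [AddCommGroup M₃] [Module (MonoidAlgebra R Γ) M₃]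

/-- Compatible weak lengths on the terms of a short exact sequence. -/
structure IsAdditiveOnExact (f : M₁ →ₗ[MonoidAlgebra R Γ] M₂) (g : M₂ →ₗ[MonoidAlgebra R Γ] M₃)
    (ℓ₁ : Set M₁ → ℝ≥0∞) (ℓ₂ : Set M₂ → ℝ≥0∞) (ℓ₃ : Set M₃ → ℝ≥0∞) : Prop where
  image_eq : ∀ B : Set M₁, ℓ₁ B = ℓ₂ (f '' B)
  add_image_le : ∀ (A₁ : Set M₁) (A₂ : Set M₂), A₁.Finite → A₂.Finite → (0 : M₁) ∈ A₁ →
    (0 : M₂) ∈ A₂ → ℓ₁ A₁ + ℓ₃ (g '' A₂) ≤ ℓ₂ (f '' A₁ + A₂)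
  exists_relBound : ∀ A : Set M₂, A.Finite → (0 : M₂) ∈ A → ∀ ε : ℝ≥0, 0 < ε →
    ∃ B : Set M₁, B.Finite ∧ (0 : M₁) ∈ B ∧
      IsWeakLength.RelBound ℓ₂ (ℓ₃ (g '' A) + ε) A (f '' B)

namespace IsAdditiveOnExact

variable {f : M₁ →ₗ[MonoidAlgebra R Γ] M₂} {g : M₂ →ₗ[MonoidAlgebra R Γ] M₃}
  {ℓ₁ : Set M₁ → ℝ≥0∞} {ℓ₂ : Set M₂ → ℝ≥0∞} {ℓ₃ : Set M₃ → ℝ≥0∞}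

theorem isWeakLength_left (h : IsAdditiveOnExact f g ℓ₁ ℓ₂ ℓ₃) (h₂ : IsWeakLength R Γ ℓ₂) :
    IsWeakLength R Γ ℓ₁ where
  mono hAB := by
    rw [h.image_eq, h.image_eq]
    exact h₂.mono (Set.image_mono hAB)
  add_le A B := by
    rw [h.image_eq, h.image_eq, h.image_eq, Set.image_add]
    exact h₂.add_le _ _
  smul_le s A := by
    rw [h.image_eq, h.image_eq, Set.image_smul_comm f _ _ fun b => f.map_smul _ b]
    exact h₂.smul_le s _
  zero := by
    rw [h.image_eq, Set.image_zero, map_zero]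
    exact h₂.zero
  lt_top hA := by
    rw [h.image_eq]
    exact h₂.lt_top (hA.image _)

theorem averageWeakLength_image (h : IsAdditiveOnExact f g ℓ₁ ℓ₂ ℓ₃) (B : Set M₁) (F : Finset Γ) :
    averageWeakLength R ℓ₂ (f '' B) F = averageWeakLength R ℓ₁ B F := by
  rw [averageWeakLength, averageWeakLength, ← image_translateSum, ← h.image_eq]

theorem meanWeakLengthOfSet_le (hΓ : IsAmenableGroup Γ) (h : IsAdditiveOnExact f g ℓ₁ ℓ₂ ℓ₃)
    (hf : Function.Injective f) (h₂ : IsWeakLength R Γ ℓ₂) (h₃ : IsWeakLength R Γ ℓ₃) {A : Set M₂}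
    (hA : A.Finite) (hA0 : (0 : M₂) ∈ A) :
    meanWeakLengthOfSet R Γ ℓ₂ A ≤
      meanWeakLengthOfSet R Γ ℓ₃ (g '' A) + meanWeakLength R Γ ℓ₁ := by
  have := moreLeftInvariant_neBot hΓ
  have h₁ := h.isWeakLength_left h₂
  have hgA : (g '' A).Finite := hA.image _
  have hgA0 : (0 : M₃) ∈ g '' A := ⟨0, hA0, map_zero g⟩
  set x := meanWeakLengthOfSet R Γ ℓ₃ (g '' A) with hx
  have hxtop : x ≠ ∞ := h₃.meanWeakLengthOfSet_ne_top hΓ hgA hgA0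
  refine ENNReal.le_add_of_forall_pos_le_mul_add hxtop (h₂.lt_top hA).ne fun ε hε => ?_
  have hε2 : 0 < ε / 2 := half_pos hε
  have hev : ∀ᶠ T : Finset Γ in moreLeftInvariant Γ,
      averageWeakLength R ℓ₃ (g '' A) T < x + (ε / 2 : ℝ≥0) :=
    (h₃.tendsto_meanWeakLengthOfSet hΓ hgA hgA0).eventually_lt_const
      (ENNReal.lt_add_right hxtop (ENNReal.coe_pos.2 hε2).ne')
  have hfreq : ∃ᶠ T : Finset Γ in moreLeftInvariant Γ, ∃ B : Set M₂, B.Finite ∧ (0 : M₂) ∈ B ∧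
      B ⊆ AddMonoidHom.mrange f.toAddMonoidHom ∧
      IsWeakLength.RelBound ℓ₂ ((x + ε) * T.card) (translateSum R A T) B := by
    refine Eventually.frequently ?_
    filter_upwards [hev, eventually_nonempty] with T hT hT0
    have h0 : (0 : ℝ≥0) < T.card := by exact_mod_cast hT0.card_pos
    have h0' : (T.card : ℝ≥0∞) ≠ 0 := by exact_mod_cast hT0.card_pos.ne'
    -- Half of ε pays for the distance of the average from its limit x, the other half, scaled by
    -- |T|, for the error of the relative bound.
    obtain ⟨B, hB, hB0, hrel⟩ := h.exists_relBound _ (finite_translateSum (R := R) hA T)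
      (zero_mem_translateSum hA0 T) (ε / 2 * T.card) (mul_pos hε2 h0)
    refine ⟨f '' B, hB.image _, ⟨0, hB0, map_zero f⟩, ?_, fun D hD hD0 =>
      (hrel D hD hD0).trans (add_le_add ?_ le_rfl)⟩
    · rintro _ ⟨b, -, rfl⟩
      exact ⟨b, rfl⟩
    · rw [image_translateSum]
      have h1 := (ENNReal.div_le_iff h0' (by simp)).1 hT.le
      refine (add_le_add h1 le_rfl).trans (le_of_eq ?_)
      rw [ENNReal.coe_mul, ENNReal.coe_natCast, ← add_mul, add_assoc, ← ENNReal.coe_add, add_halves]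
  obtain ⟨B, hB, hB0, hBf, hF⟩ := h₂.eventually_translateSum_le _ hA hA0 (x + ε) hfreq hε
  -- The common correction lies in the range of f, so it comes from a finite set in M₁ whose mean
  -- weak length is at most that of M₁.
  have hBim : f '' (f ⁻¹' B) = B := Set.image_preimage_eq_of_subset hBf
  have hB1 : (f ⁻¹' B).Finite := hB.preimage hf.injOn
  have hB10 : (0 : M₁) ∈ f ⁻¹' B := by
    rw [Set.mem_preimage, map_zero]
    exact hB0
  refine le_trans ?_ (add_le_add le_rfl
    (IsWeakLength.meanWeakLengthOfSet_le_meanWeakLength (R := R) (Γ := Γ) hB1 hB10))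
  refine le_of_tendsto_of_tendsto (h₂.tendsto_meanWeakLengthOfSet hΓ hA hA0)
    ((h₁.tendsto_meanWeakLengthOfSet hΓ hB1 hB10).const_add _) ?_
  filter_upwards [hF, eventually_nonempty] with F hF hF0
  rw [← h.averageWeakLength_image, hBim]
  exact IsWeakLength.averageWeakLength_le_of_le _ _ _ hF0 (hF.trans (le_of_eq (by ring)))

theorem add_meanWeakLengthOfSet_le (hΓ : IsAmenableGroup Γ) (h : IsAdditiveOnExact f g ℓ₁ ℓ₂ ℓ₃)
    (h₂ : IsWeakLength R Γ ℓ₂) (h₃ : IsWeakLength R Γ ℓ₃) {A₁ : Set M₁} {A₂ : Set M₂}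
    (hA₁ : A₁.Finite) (hA₂ : A₂.Finite) (hA₁0 : (0 : M₁) ∈ A₁) (hA₂0 : (0 : M₂) ∈ A₂) :
    meanWeakLengthOfSet R Γ ℓ₁ A₁ + meanWeakLengthOfSet R Γ ℓ₃ (g '' A₂) ≤
      meanWeakLengthOfSet R Γ ℓ₂ (f '' A₁ + A₂) := by
  have := moreLeftInvariant_neBot hΓ
  refine le_of_tendsto_of_tendsto'
    (((h.isWeakLength_left h₂).tendsto_meanWeakLengthOfSet hΓ hA₁ hA₁0).add
      (h₃.tendsto_meanWeakLengthOfSet hΓ (hA₂.image g) ⟨0, hA₂0, map_zero g⟩))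
    (h₂.tendsto_meanWeakLengthOfSet hΓ ((hA₁.image f).add hA₂)
      ⟨0, ⟨0, hA₁0, map_zero f⟩, 0, hA₂0, add_zero 0⟩) fun F => ?_
  simp only [averageWeakLength]
  rw [← ENNReal.add_div, translateSum_add, ← image_translateSum, ← image_translateSum]
  exact ENNReal.div_le_div_right (h.add_image_le _ _ (finite_translateSum hA₁ F)
    (finite_translateSum hA₂ F) (zero_mem_translateSum hA₁0 F) (zero_mem_translateSum hA₂0 F)) _

/-- The addition formula for mean weak lengths. -/
theorem meanWeakLength_eq (hΓ : IsAmenableGroup Γ) (h : IsAdditiveOnExact f g ℓ₁ ℓ₂ ℓ₃)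
    (hf : Function.Injective f) (hg : Function.Surjective g) (h₂ : IsWeakLength R Γ ℓ₂)
    (h₃ : IsWeakLength R Γ ℓ₃) :
    meanWeakLength R Γ ℓ₂ = meanWeakLength R Γ ℓ₁ + meanWeakLength R Γ ℓ₃ := by
  classical
  refine le_antisymm (iSup₂_le fun A hA0 => ?_) ?_
  · rw [add_comm]
    exact (h.meanWeakLengthOfSet_le hΓ hf h₂ h₃ A.finite_toSet hA0).trans (add_le_add
      (IsWeakLength.meanWeakLengthOfSet_le_meanWeakLength (A.finite_toSet.image g)
        ⟨0, hA0, map_zero g⟩) le_rfl)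
  · refine ENNReal.biSup_add_biSup_le' (p := fun A₁ : Finset M₁ => (0 : M₁) ∈ A₁)
      (q := fun A₃ : Finset M₃ => (0 : M₃) ∈ A₃) ⟨{0}, Finset.mem_singleton_self 0⟩
      ⟨{0}, Finset.mem_singleton_self 0⟩ fun A₁ hA₁ A₃ hA₃ => ?_
    obtain ⟨σ, hσ⟩ := hg.hasRightInverse
    -- A finite lift of A₃; the section need not preserve 0, which is therefore added by hand.
    set A₂ : Set M₂ := insert 0 (σ '' (A₃ : Set M₃)) with hA₂
    have hA₂fin : A₂.Finite := (A₃.finite_toSet.image σ).insert 0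
    have hgA₂ : g '' A₂ = A₃ := by
      rw [hA₂, Set.image_insert_eq, map_zero, Set.image_image]
      simp only [hσ _, Set.image_id']
      exact Set.insert_eq_of_mem hA₃
    have h1 := h.add_meanWeakLengthOfSet_le hΓ h₂ h₃ A₁.finite_toSet hA₂fin hA₁
      (Set.mem_insert 0 _)
    rw [hgA₂] at h1
    exact h1.trans (IsWeakLength.meanWeakLengthOfSet_le_meanWeakLength
      ((A₁.finite_toSet.image f).add hA₂fin)
      ⟨0, ⟨0, hA₁, map_zero f⟩, 0, Set.mem_insert 0 _, add_zero 0⟩)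

end IsAdditiveOnExact

end Addition

/-! ### The weak length log |A| -/

section LogCard

theorem logCard_of_finite {M : Type v} {A : Set M} (hA : A.Finite) :
    logCard A = ENNReal.ofReal (Real.log (A.ncard : ℝ)) :=
  if_pos hA

theorem logCard_le_of_ncard_le {M N : Type v} {A : Set M} {B : Set N} (hA : A.Finite)
    (h : B.Finite → A.ncard ≤ B.ncard) : logCard A ≤ logCard B := by
  by_cases hB : B.Finite
  · rw [logCard_of_finite hA, logCard_of_finite hB]
    refine ENNReal.ofReal_le_ofReal ?_
    rcases Nat.eq_zero_or_pos A.ncard with h0 | h0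
    · rw [h0, Nat.cast_zero, Real.log_zero]
      exact Real.log_natCast_nonneg _
    · exact Real.log_le_log (by exact_mod_cast h0) (by exact_mod_cast h hB)
  · rw [logCard, logCard, if_neg hB]
    exact le_top

theorem logCard_mono {M : Type v} {A B : Set M} (h : A ⊆ B) : logCard A ≤ logCard B := by
  by_cases hB : B.Finite
  · exact logCard_le_of_ncard_le (hB.subset h) fun hB => Set.ncard_le_ncard h hB
  · rw [logCard, logCard, if_neg hB]
    exact le_top

theorem logCard_image_of_injOn {M N : Type v} {A : Set M} {f : M → N} (hf : Set.InjOn f A) :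
    logCard (f '' A) = logCard A := by
  rw [logCard, logCard, Set.finite_image_iff hf, hf.ncard_image]

theorem logCard_image_le {M N : Type v} (A : Set M) (f : M → N) :
    logCard (f '' A) ≤ logCard A := by
  by_cases hA : A.Finite
  · exact logCard_le_of_ncard_le (hA.image f) fun _ => Set.ncard_image_le hA
  · rw [logCard, logCard, if_neg hA]
    exact le_top

theorem logCard_prod {M N : Type v} {A : Set M} {B : Set N} (hA : A.Finite) (hB : B.Finite)
    (hA' : A.Nonempty) (hB' : B.Nonempty) : logCard (A ×ˢ B) = logCard A + logCard B := by
  have h1 : (A.ncard : ℝ) ≠ 0 := by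
    exact_mod_cast (Set.ncard_pos hA).2 hA' |>.ne'
  have h2 : (B.ncard : ℝ) ≠ 0 := by
    exact_mod_cast (Set.ncard_pos hB).2 hB' |>.ne'
  rw [logCard_of_finite hA, logCard_of_finite hB, logCard_of_finite (hA.prod hB), Set.ncard_prod,
    Nat.cast_mul, Real.log_mul h1 h2,
    ENNReal.ofReal_add (Real.log_natCast_nonneg _) (Real.log_natCast_nonneg _)]

theorem logCard_add_le {M : Type v} [AddCommGroup M] (A B : Set M) :
    logCard (A + B) ≤ logCard A + logCard B := by
  -- Empty sets are split off because `Real.log 0 = 0` breaks the product formula for them.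
  rcases A.eq_empty_or_nonempty with rfl | hA'
  · rw [Set.empty_add]
    exact le_self_add
  rcases B.eq_empty_or_nonempty with rfl | hB'
  · rw [Set.add_empty]
    exact le_add_self
  by_cases hA : A.Finite
  · by_cases hB : B.Finite
    · rw [← logCard_prod hA hB hA' hB', ← Set.add_image_prod]
      exact logCard_image_le _ _
    · rw [logCard, logCard, logCard, if_neg hB, add_top]
      exact le_top
  · rw [logCard, logCard, logCard, if_neg hA, top_add]
    exact le_top

variable {R : Type u} [Ring R] {Γ : Type w} [Group Γ] {M₁ M₂ M₃ : Type v}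
  [AddCommGroup M₁] [Module (MonoidAlgebra R Γ) M₁]
  [AddCommGroup M₂] [Module (MonoidAlgebra R Γ) M₂]
  [AddCommGroup M₃] [Module (MonoidAlgebra R Γ) M₃]

theorem isWeakLength_logCard : IsWeakLength R Γ (logCard : Set M₁ → ℝ≥0∞) where
  mono := logCard_mono
  add_le := logCard_add_le
  smul_le _ _ := logCard_image_le _ _
  zero := by
    rw [logCard_of_finite Set.finite_zero, ← Set.singleton_zero, Set.ncard_singleton, Nat.cast_one,
      Real.log_one, ENNReal.ofReal_zero]
  lt_top hA := by
    rw [logCard_of_finite hA]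
    exact ENNReal.ofReal_lt_top

/-- Choose preimages σ(y) ∈ A₂ of the points of gA₂. Then (a, y) ↦ f(a) + σ(y) is injective into fA₁
+ A₂. Conversely, with σ choosing in A, each a ∈ A differs from σ(g a) by an element of (A - A) ∩ im
f, which is the correction. -/
theorem isAdditiveOnExact_logCard {f : M₁ →ₗ[MonoidAlgebra R Γ] M₂}
    {g : M₂ →ₗ[MonoidAlgebra R Γ] M₃} (hf : Function.Injective f) (hfg : Function.Exact f g) :
    IsAdditiveOnExact f g logCard logCard logCard where
  image_eq B := (logCard_image_of_injOn hf.injOn).symm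
  add_image_le A₁ A₂ hA₁ hA₂ hA₁0 hA₂0 := by
    choose! σ hσ using fun y (hy : y ∈ g '' A₂) => hy
    rw [← logCard_prod hA₁ (hA₂.image g) ⟨0, hA₁0⟩ ⟨_, 0, hA₂0, rfl⟩]
    have hinj : Set.InjOn (fun p : M₁ × M₃ => f p.1 + σ p.2) (A₁ ×ˢ (g '' A₂)) := by
      rintro ⟨a, y⟩ hy ⟨a', y'⟩ hy' heq
      simp only at heq
      have h1 := congrArg g heq
      rw [map_add, map_add, hfg.apply_apply_eq_zero, hfg.apply_apply_eq_zero, zero_add, zero_add,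
        (hσ y hy.2).2, (hσ y' hy'.2).2] at h1
      subst h1
      rw [hf (add_right_cancel heq)]
    rw [← logCard_image_of_injOn hinj]
    refine logCard_mono ?_
    rintro _ ⟨⟨a, y⟩, hy, rfl⟩
    exact Set.add_mem_add ⟨a, hy.1, rfl⟩ (hσ y hy.2).1
  exists_relBound A hA hA0 ε _ := by
    choose! σ hσ using fun y (hy : y ∈ g '' A) => hy
    refine ⟨f ⁻¹' (A - A), (hA.sub hA).preimage hf.injOn, ?_, fun D _ _ => ?_⟩
    · rw [Set.mem_preimage, map_zero]
      exact ⟨0, hA0, 0, hA0, sub_zero 0⟩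
    · have hsub : A ⊆ σ '' (g '' A) + f '' (f ⁻¹' (A - A)) := by
        intro a ha
        obtain ⟨h1, h2⟩ := hσ (g a) ⟨a, ha, rfl⟩
        obtain ⟨b, hb⟩ := (hfg (a - σ (g a))).1 (by rw [map_sub, h2, sub_self])
        refine ⟨_, ⟨g a, ⟨a, ha, rfl⟩, rfl⟩, f b, ⟨b, ?_, rfl⟩, ?_⟩
        · rw [Set.mem_preimage, hb]
          exact Set.sub_mem_sub ha h1
        · rw [hb]
          exact add_sub_cancel _ _
      calc logCard (A + D) ≤ logCard (σ '' (g '' A) + f '' (f ⁻¹' (A - A)) + D) :=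
            logCard_mono (Set.add_subset_add_right hsub)
        _ ≤ logCard (σ '' (g '' A)) + logCard (f '' (f ⁻¹' (A - A)) + D) := by
            rw [add_assoc]
            exact logCard_add_le _ _
        _ ≤ _ := add_le_add ((logCard_image_le _ _).trans le_self_add) le_rfl

end LogCard

/-! ### Weak lengths induced by length functions -/

namespace LengthFunction

variable {R : Type u} [Ring R] (L : LengthFunction.{u, v} R)

section Module

variable {M N : Type v} [AddCommGroup M] [Module R M] [AddCommGroup N] [Module R N]

theorem len_eq_ker_add_range (g : M →ₗ[R] N) :
    L.len M = L.len (LinearMap.ker g) + L.len (LinearMap.range g) :=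
  L.additive _ _ _ (LinearMap.ker g).subtype g.rangeRestrict (LinearMap.ker g).injective_subtype
    (by
      intro x
      rw [← LinearMap.mem_ker, LinearMap.ker_rangeRestrict, Submodule.coe_subtype,
        Subtype.range_coe]
      rfl)
    g.surjective_rangeRestrict

theorem len_eq_of_equiv (e : M ≃ₗ[R] N) : L.len M = L.len N := by
  have h := L.additive PUnit.{v + 1} M N 0 e.toLinearMap (fun _ _ _ => rfl)
    (fun x => by simp [eq_comm (a := (0 : M))]) e.surjective
  rwa [L.len_zero PUnit.{v + 1}, zero_add] at h

theorem len_inf_ker_add_map (P : Submodule R M) (g : M →ₗ[R] N) :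
    L.len P = L.len (P ⊓ LinearMap.ker g : Submodule R M) + L.len (P.map g) := by
  rw [L.len_eq_ker_add_range (g.domRestrict P), LinearMap.range_domRestrict]
  congr 1
  have h : (LinearMap.ker (g.domRestrict P)).map P.subtype = P ⊓ LinearMap.ker g := by
    rw [LinearMap.ker_domRestrict, Submodule.map_comap_subtype]
  rw [← h]
  exact L.len_eq_of_equiv (Submodule.equivMapOfInjective _ P.injective_subtype _)

theorem len_mono {P Q : Submodule R M} (h : P ≤ Q) : L.len P ≤ L.len Q := by
  have h1 := L.len_inf_ker_add_map Q P.mkQ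
  rw [Submodule.ker_mkQ, inf_eq_right.2 h] at h1
  exact le_self_add.trans h1.ge

theorem len_map_le (P : Submodule R M) (g : M →ₗ[R] N) : L.len (P.map g) ≤ L.len P := by
  rw [L.len_inf_ker_add_map P g]
  exact le_add_self

theorem len_map_of_injective (P : Submodule R M) {g : M →ₗ[R] N} (hg : Function.Injective g) :
    L.len (P.map g) = L.len P :=
  (L.len_eq_of_equiv (Submodule.equivMapOfInjective g hg P)).symm

/-- P + Q and P have the same image modulo Q, with kernels Q and P ∩ Q. -/
theorem len_sup_add_len_inf (P Q : Submodule R M) :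
    L.len (P ⊔ Q : Submodule R M) + L.len (P ⊓ Q : Submodule R M) = L.len P + L.len Q := by
  have h1 := L.len_inf_ker_add_map (P ⊔ Q) Q.mkQ
  have h2 := L.len_inf_ker_add_map P Q.mkQ
  have h3 : Q.map Q.mkQ = ⊥ := by
    rw [← LinearMap.le_ker_iff_map, Submodule.ker_mkQ]
  rw [Submodule.ker_mkQ, inf_eq_right.2 le_sup_right, Submodule.map_sup, h3, sup_bot_eq] at h1
  rw [Submodule.ker_mkQ] at h2
  rw [h1, h2]
  ring

theorem len_sup_le (P Q : Submodule R M) :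
    L.len (P ⊔ Q : Submodule R M) ≤ L.len P + L.len Q :=
  le_self_add.trans (L.len_sup_add_len_inf P Q).le

theorem exists_fg_le_len_add {P : Submodule R M} (hP : L.len P ≠ ∞) {ε : ℝ≥0} (hε : 0 < ε) :
    ∃ Q ≤ P, Q.FG ∧ L.len P ≤ L.len Q + ε := by
  by_contra! hcon
  have h1 : ⨆ (N : Submodule R P) (_ : N.FG), L.len N + ε ≤ L.len P := by
    refine iSup₂_le fun N hN => ?_
    have h2 := hcon (N.map P.subtype) (Submodule.map_subtype_le P N) (hN.map _)
    rw [L.len_map_of_injective N P.injective_subtype] at h2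
    exact h2.le
  rw [← ENNReal.biSup_add' ⟨⊥, Submodule.fg_bot⟩, ← L.upper_continuous P] at h1
  exact absurd h1 (not_le.2 (ENNReal.lt_add_right hP (ENNReal.coe_pos.2 hε).ne'))

theorem span_add_le (A B : Set M) :
    Submodule.span R (A + B) ≤ Submodule.span R A ⊔ Submodule.span R B := by
  rw [Submodule.span_le]
  rintro _ ⟨a, ha, b, hb, rfl⟩
  exact Submodule.add_mem_sup (Submodule.subset_span ha) (Submodule.subset_span hb)

theorem span_add_eq {A B : Set M} (hA : (0 : M) ∈ A) (hB : (0 : M) ∈ B) :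
    Submodule.span R (A + B) = Submodule.span R A ⊔ Submodule.span R B :=
  le_antisymm (span_add_le A B) (sup_le (Submodule.span_mono (Set.subset_add_left _ hB))
    (Submodule.span_mono (Set.subset_add_right _ hA)))

end Module

variable {L} {Γ : Type w} [Group Γ]

theorem LocallyFinite.isWeakLength {M : Type v} [AddCommGroup M] [Module (MonoidAlgebra R Γ) M]
    [Module R M] [IsScalarTower R (MonoidAlgebra R Γ) M] (hM : L.LocallyFinite M) :
    IsWeakLength R Γ (L.weakLength : Set M → ℝ≥0∞) where
  mono h := L.len_mono (Submodule.span_mono h)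
  add_le A B := (L.len_mono (span_add_le A B)).trans (L.len_sup_le _ _)
  smul_le s A := by
    -- Group elements commute with the scalars r • 1 in the group ring, so s acts R-linearly.
    let φ : M →ₗ[R] M :=
      { toFun := fun m => MonoidAlgebra.of R Γ s • m
        map_add' := smul_add _
        map_smul' := fun r m => by
          have h : MonoidAlgebra.of R Γ s * r • (1 : MonoidAlgebra R Γ) =
              r • MonoidAlgebra.of R Γ s := by
            simp [MonoidAlgebra.one_def, MonoidAlgebra.single_mul_single]
          rw [← one_smul (MonoidAlgebra R Γ) m, ← smul_assoc r (1 : MonoidAlgebra R Γ) m,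
            smul_smul, h, smul_assoc, one_smul]
          rfl }
    have h : Submodule.span R (MonoidAlgebra.of R Γ s • A) = (Submodule.span R A).map φ := by
      rw [Submodule.map_span]
      rfl
    rw [weakLength, h]
    exact L.len_map_le _ φ
  zero := by
    have : Subsingleton (Submodule.span R (0 : Set M)) := by
      rw [← Set.singleton_zero, Submodule.span_zero_singleton]
      infer_instance
    exact L.len_zero _
  lt_top hA := hM _ (Submodule.fg_span hA)

variable {M₁ M₂ M₃ : Type v}
  [AddCommGroup M₁] [Module (MonoidAlgebra R Γ) M₁] [Module R M₁]
  [IsScalarTower R (MonoidAlgebra R Γ) M₁]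
  [AddCommGroup M₂] [Module (MonoidAlgebra R Γ) M₂] [Module R M₂]
  [IsScalarTower R (MonoidAlgebra R Γ) M₂]
  [AddCommGroup M₃] [Module (MonoidAlgebra R Γ) M₃] [Module R M₃]
  [IsScalarTower R (MonoidAlgebra R Γ) M₃]

theorem LocallyFinite.of_surjective {M N : Type v} [AddCommGroup M] [Module R M] [AddCommGroup N]
    [Module R N] (hM : L.LocallyFinite M) {g : M →ₗ[R] N} (hg : Function.Surjective g) :
    L.LocallyFinite N := by
  intro P hP
  obtain ⟨S, rfl⟩ := hP
  obtain ⟨σ, hσ⟩ := hg.hasRightInverse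
  have h : Submodule.span R (S : Set N) = (Submodule.span R (σ '' (S : Set N))).map g := by
    rw [Submodule.map_span, Set.image_image]
    simp only [hσ _, Set.image_id']
  rw [h]
  exact (L.len_map_le _ g).trans_lt (hM _ (Submodule.fg_span (S.finite_toSet.image σ)))

theorem LocallyFinite.isAdditiveOnExact (hM : L.LocallyFinite M₂)
    {f : M₁ →ₗ[MonoidAlgebra R Γ] M₂} {g : M₂ →ₗ[MonoidAlgebra R Γ] M₃}
    (hf : Function.Injective f) (hfg : Function.Exact f g) :
    IsAdditiveOnExact f g L.weakLength L.weakLength L.weakLength := by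
  have hspanf : ∀ B : Set M₁, Submodule.span R (f '' B) =
      (Submodule.span R B).map (f.restrictScalars R) := fun B => by
    rw [Submodule.map_span]
    rfl
  have hspang : ∀ A : Set M₂, Submodule.span R (g '' A) =
      (Submodule.span R A).map (g.restrictScalars R) := fun A => by
    rw [Submodule.map_span]
    rfl
  have hker : ∀ m : M₂, m ∈ LinearMap.ker (g.restrictScalars R) ↔ m ∈ Set.range f := fun m => hfg m
  refine ⟨fun B => ?_, fun A₁ A₂ _ _ hA₁ hA₂ => ?_, fun A hA hA0 ε hε => ?_⟩
  · rw [weakLength, weakLength, hspanf, L.len_map_of_injective _ hf]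
  · have hfA₁ : (0 : M₂) ∈ f '' A₁ := ⟨0, hA₁, map_zero f⟩
    rw [weakLength, weakLength, weakLength, span_add_eq hfA₁ hA₂, hspanf, hspang,
      ← L.len_map_of_injective (Submodule.span R A₁) (g := f.restrictScalars R) hf,
      L.len_inf_ker_add_map (_ ⊔ _) (g.restrictScalars R)]
    refine add_le_add (L.len_mono (le_inf le_sup_left ?_))
      (L.len_mono (Submodule.map_mono le_sup_right))
    rintro _ ⟨m, -, rfl⟩
    exact (hker _).2 ⟨m, rfl⟩
  -- W = V ∩ ker g need not be finitely generated, so upper continuity supplies a finitely generated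
  -- Q ≤ W within ε of it in length; generators of Q give the correction. With X = Q + ⟨D⟩, the
  -- modular law for V and X, where Q ≤ V ∩ X, gives the bound after cancelling the finite L(Q).
  · set V := Submodule.span R A with hV
    have hVtop : L.len V ≠ ∞ := (hM V (Submodule.fg_span hA)).ne
    set W := V ⊓ LinearMap.ker (g.restrictScalars R) with hW
    have hWtop : L.len W ≠ ∞ := ne_top_of_le_ne_top hVtop (L.len_mono inf_le_left)
    obtain ⟨Q, hQW, ⟨S, hS⟩, hlen⟩ := L.exists_fg_le_len_add hWtop hε
    have hQtop : L.len Q ≠ ∞ := ne_top_of_le_ne_top hWtop (L.len_mono hQW)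
    have hSf : (S : Set M₂) ⊆ Set.range f := fun s hs =>
      (hker s).1 (inf_le_right (a := V) (hQW (hS ▸ Submodule.subset_span hs)))
    refine ⟨insert 0 (f ⁻¹' S), (S.finite_toSet.preimage hf.injOn).insert 0, Set.mem_insert 0 _,
      fun D _ hD0 => ?_⟩
    have hfB : Submodule.span R (f '' insert 0 (f ⁻¹' S)) = Q := by
      rw [Set.image_insert_eq, map_zero, Submodule.span_insert_zero,
        Set.image_preimage_eq_of_subset hSf, hS]
    have hfB0 : (0 : M₂) ∈ f '' insert 0 (f ⁻¹' S) := ⟨0, Set.mem_insert 0 _, map_zero f⟩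
    rw [weakLength, weakLength, weakLength, span_add_eq hA0 hD0, span_add_eq hfB0 hD0, hfB, hspang]
    set X := Q ⊔ Submodule.span R D with hX
    have h1 : L.len (V ⊔ Submodule.span R D : Submodule R M₂) ≤
        L.len (V ⊔ X : Submodule R M₂) := L.len_mono (sup_le_sup_left le_sup_right V)
    have h2 : L.len Q ≤ L.len (V ⊓ X : Submodule R M₂) :=
      L.len_mono (le_inf (hQW.trans inf_le_left) le_sup_left)
    refine h1.trans ((ENNReal.add_le_add_iff_right hQtop).1 ?_)
    calc L.len (V ⊔ X : Submodule R M₂) + L.len Q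
        ≤ L.len V + L.len X := (add_le_add le_rfl h2).trans (L.len_sup_add_len_inf V X).le
      _ = L.len W + L.len (V.map (g.restrictScalars R)) + L.len X := by
          rw [hW, ← L.len_inf_ker_add_map]
      _ ≤ L.len Q + ε + L.len (V.map (g.restrictScalars R)) + L.len X := by gcongr
      _ = _ := by ring

end LengthFunction

/-- The two items are the addition formulas for algebraic entropy and for mean length; each is
preceded by the existence (as a finite number) of the limits which define the invariants. -/
theorem corollary1p3 {Γ : Type w} [Group Γ] (hΓ : IsAmenableGroup Γ) :
    (∀ (M₂ : Type v) [AddCommGroup M₂] [Module (MonoidAlgebra ℤ Γ) M₂],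
      (∀ A : Finset M₂, (0 : M₂) ∈ A → ∃ c : ℝ≥0,
        Tendsto (averageWeakLength (Γ := Γ) ℤ logCard (A : Set M₂)) (moreLeftInvariant Γ)
          (𝓝 (c : ℝ≥0∞))) ∧
      ∀ M₁ : Submodule (MonoidAlgebra ℤ Γ) M₂,
        algebraicEntropy Γ M₂ = algebraicEntropy Γ M₁ + algebraicEntropy Γ (M₂ ⧸ M₁)) ∧
    (∀ (R : Type u) [Ring R] (L : LengthFunction.{u, v} R)
      (N₂ : Type v) [AddCommGroup N₂] [Module (MonoidAlgebra R Γ) N₂] [Module R N₂]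
      [IsScalarTower R (MonoidAlgebra R Γ) N₂], L.LocallyFinite N₂ →
      (∀ A : Finset N₂, (0 : N₂) ∈ A → ∃ c : ℝ≥0,
        Tendsto (averageWeakLength (Γ := Γ) R L.weakLength (A : Set N₂)) (moreLeftInvariant Γ)
          (𝓝 (c : ℝ≥0∞))) ∧
      ∀ N₁ : Submodule (MonoidAlgebra R Γ) N₂,
        L.meanLength Γ N₂ = L.meanLength Γ N₁ + L.meanLength Γ (N₂ ⧸ N₁)) := by
  refine ⟨fun M₂ _ _ => ⟨fun A hA => isWeakLength_logCard.exists_tendsto hΓ A.finite_toSet hA,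
    fun M₁ => ?_⟩, fun R _ L N₂ _ _ _ _ hN₂ =>
    ⟨fun A hA => hN₂.isWeakLength.exists_tendsto hΓ A.finite_toSet hA, fun N₁ => ?_⟩⟩
  · exact (isAdditiveOnExact_logCard M₁.injective_subtype
      (LinearMap.exact_subtype_mkQ M₁)).meanWeakLength_eq hΓ M₁.injective_subtype M₁.mkQ_surjective
      isWeakLength_logCard isWeakLength_logCard
  -- Only the quotient needs checking: the weak length on N₁ inherits its properties from N₂ through
  -- the inclusion.
  · have h₃ : L.LocallyFinite (N₂ ⧸ N₁) :=
      hN₂.of_surjective (g := N₁.mkQ.restrictScalars R) N₁.mkQ_surjective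
    exact (hN₂.isAdditiveOnExact N₁.injective_subtype
      (LinearMap.exact_subtype_mkQ N₁)).meanWeakLength_eq hΓ N₁.injective_subtype N₁.mkQ_surjective
      hN₂.isWeakLength h₃.isWeakLength
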